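/- Let $\mathbb{D}=\{z\in\mathbb{C}:|z|<1\}$ and let $\beta=(\beta_n)_{n\ge 0}$ be a sequence of positive numbers. Let $H^2(\beta)$ be the space of analytic functions $f(z)=\sum_{n\ge 0}a_nz^n$ on $\mathbb{D}$ such that $\|f\|^2:=\sum_{n\ge 0}|a_n|^2\beta_n<\infty$. Assume that $\lim_{n\to\infty}\beta_n^{1/n}=1$, and that for every non-constant analytic map $\varphi:\mathbb{D}\to\mathbb{D}$ with $\varphi\in H^2(\beta)$, the composition operator $C_\varphi f=f\circ\varphi$ is bounded on $H^2(\beta)$ (that is, it maps $H^2(\beta)$ into itself and there is $K$ with $\|f\circ\varphi\|\le K\|f\|$ for all $f\in H^2(\beta)$). Then $\beta$ is slowly oscillating: there are constants $0<c<1<C$ such that $c\,\beta_n\le\beta_m\le C\,\beta_n$ for all integers $m,n\ge 0$ with $n/2\le m\le 2n$. -/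

import Mathlib

open Filter Topology

namespace WeightedHardy

/-- The open unit disk. Functions on the disk are represented by functions `ℂ → ℂ`, of which every
notion below only uses the values on the disk. -/
def disk : Set ℂ := Metric.ball (0 : ℂ) 1

/-- The `n`-th Taylor coefficient at `0`, so that `f z = ∑ aₙ zⁿ` on the disk if `f` is analytic
there. -/
noncomputable def coeff (f : ℂ → ℂ) (n : ℕ) : ℂ := iteratedDeriv n f 0 / (n.factorial : ℂ)

/-- The weighted Hardy space `H²(β)`: analytic functions on the disk with `∑ |aₙ|² βₙ < ∞`. -/
def H2 (β : ℕ → ℝ) : Set (ℂ → ℂ) :=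
  {f | DifferentiableOn ℂ f disk ∧ Summable fun n : ℕ => ‖coeff f n‖ ^ 2 * β n}

/-- The norm of `H²(β)`: `‖f‖² = ∑ |aₙ|² βₙ`. -/
noncomputable def norm2 (β : ℕ → ℝ) (f : ℂ → ℂ) : ℝ :=
  Real.sqrt (∑' n : ℕ, ‖coeff f n‖ ^ 2 * β n)

/-- A symbol: a non-constant analytic self-map of the disk. -/
structure IsSymbol (φ : ℂ → ℂ) : Prop where
  differentiableOn : DifferentiableOn ℂ φ disk
  mapsTo : Set.MapsTo φ disk disk
  nonconstant : ¬ ∃ c : ℂ, ∀ z ∈ disk, φ z = c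

/-- The composition operator `f ↦ f ∘ φ` maps `H²(β)` to itself and is bounded there. -/
def BoundedComposition (β : ℕ → ℝ) (φ : ℂ → ℂ) : Prop :=
  ∃ K : ℝ, ∀ f ∈ H2 β, f ∘ φ ∈ H2 β ∧ norm2 β (f ∘ φ) ≤ K * norm2 β f

/-- `β` is slowly oscillating. -/
def SlowlyOscillating (β : ℕ → ℝ) : Prop :=
  ∃ c C : ℝ, 0 < c ∧ c < 1 ∧ 1 < C ∧
    ∀ m n : ℕ, (n : ℝ) / 2 ≤ (m : ℝ) → (m : ℝ) ≤ 2 * (n : ℝ) →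
      c * β n ≤ β m ∧ β m ≤ C * β n

end WeightedHardy

namespace WeightedHardy
open PowerSeries

/-! A single symbol suffices: the automorphism T(z) = (1 + 2z)/(2 + z), which lies in H²(β) because
βₙ grows subexponentially while its coefficients decay geometrically. Write Tⁿ = ∑ a(n,k) zᵏ.
Boundedness on zⁿ gives ∑ₖ a(n,k)² βₖ ≤ K² βₙ. Changing the signs of the a(n,k) does not increase
this weighted norm, so composing again with a suitably signed partial sum gives (∑ₖ |a(n,k)|
|a(k,m)|)² βₘ ≤ K⁴ βₙ. It remains to bound that sum below when n and m are within a factor 2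
(`sum_abs_mul_abs_ge`).

By Dirichlet unitarity, m |a(k,m)| = k |a(m,k)| (`abs_autCoeff_symm`), so it is enough that |a(n,k)|
and |a(m,k)| are simultaneously of order n^(-1/2) for a positive proportion of k. For fixed n, uₖ =
k a(n,k) satisfies a three-term recurrence, oscillatory for n/3 < k < 3n. There a positive definite
quadratic energy changes by a factor 1 + O(1/n) per step, so its values are all comparable
(`energy_comparable`). An ℓ² identity forces substantial mass into the bulk
(`tsum_discriminant_ge`), so the energy is at least of order n (`energy_lower_bound`). For k between
n and 5n/2, at most one of three consecutive uₖ is then small, and two such sequences share a large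
index (`exists_common_large`). -/

/-- The reciprocal of `2 + X`. -/
noncomputable def recip : ℝ⟦X⟧ := (C 2 + X)⁻¹

/-- The power series of the disk automorphism `z ↦ (1 + 2 z) / (2 + z)`. -/
noncomputable def autSeries : ℝ⟦X⟧ := (1 + C 2 * X) * recip

/-- The coefficient of `z ^ k` in the `n`-th power of `autSeries`. -/
noncomputable def autCoeff (n k : ℕ) : ℝ := PowerSeries.coeff k (autSeries ^ n)

/-- Power series whose coefficients decay like `(3 / 4) ^ k`. -/
def Decays (g : ℝ⟦X⟧) : Prop := ∃ B : ℝ, ∀ k, |PowerSeries.coeff k g| ≤ B * (3 / 4 : ℝ) ^ k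

/-- The square of the `ℓ²`-norm of the coefficients. -/
noncomputable def sqNorm (g : ℝ⟦X⟧) : ℝ := ∑' k, (PowerSeries.coeff k g) ^ 2

/-! ### Power series algebra of T. -/

theorem mul_recip : (C 2 + X) * recip = 1 :=
  PowerSeries.mul_inv_cancel _ (by simp)

theorem mul_autSeries : (C 2 + X) * autSeries = 1 + C 2 * X := by
  unfold autSeries
  linear_combination (1 + C 2 * X) * mul_recip

theorem C_ofNat (m : ℕ) [m.AtLeastTwo] : (C (ofNat(m) : ℝ) : ℝ⟦X⟧) = ofNat(m) :=
  map_ofNat _ _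

theorem derivative_recip : d⁄dX ℝ recip = - recip ^ 2 := by
  have h := congrArg (d⁄dX ℝ) mul_recip
  simp only [Derivation.leibniz, map_add, PowerSeries.derivative_C, PowerSeries.derivative_X,
    smul_eq_mul, Derivation.map_one_eq_zero] at h
  linear_combination recip * h - d⁄dX ℝ recip * mul_recip

theorem derivative_autSeries : d⁄dX ℝ autSeries = 3 * recip ^ 2 := by
  unfold autSeries
  simp only [Derivation.leibniz, map_add, PowerSeries.derivative_C, PowerSeries.derivative_X,
    smul_eq_mul, Derivation.map_one_eq_zero, derivative_recip]
  have h := mul_recip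
  rw [C_ofNat] at *
  linear_combination (-2 * recip) * h

theorem coeff_zero_two_add_mul (g : ℝ⟦X⟧) :
    PowerSeries.coeff 0 ((C 2 + X) * g) = 2 * PowerSeries.coeff 0 g := by
  simp [add_mul]

theorem coeff_succ_two_add_mul (g : ℝ⟦X⟧) (k : ℕ) : PowerSeries.coeff (k + 1) ((C 2 + X) * g) =
    2 * PowerSeries.coeff (k + 1) g + PowerSeries.coeff k g := by
  simp [add_mul, PowerSeries.coeff_succ_X_mul]

theorem coeff_zero_one_add_mul (g : ℝ⟦X⟧) :
    PowerSeries.coeff 0 ((1 + C 2 * X) * g) = PowerSeries.coeff 0 g := by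
  simp [add_mul, mul_assoc]

theorem coeff_succ_one_add_mul (g : ℝ⟦X⟧) (k : ℕ) :
    PowerSeries.coeff (k + 1) ((1 + C 2 * X) * g) =
      PowerSeries.coeff (k + 1) g + 2 * PowerSeries.coeff k g := by
  simp [add_mul, mul_assoc, PowerSeries.coeff_succ_X_mul]

/-! ### Geometric decay, and multiplication by T as an ℓ² isometry. -/

theorem Decays.nonneg {g : ℝ⟦X⟧} {B : ℝ}
    (h : ∀ k, |PowerSeries.coeff k g| ≤ B * (3 / 4 : ℝ) ^ k) : 0 ≤ B := by
  have := h 0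
  simp only [pow_zero, mul_one] at this
  exact (abs_nonneg _).trans this

theorem Decays.X_mul {g : ℝ⟦X⟧} (h : Decays g) : Decays (X * g) := by
  obtain ⟨B, hB⟩ := h
  have hB0 := Decays.nonneg hB
  refine ⟨2 * B, fun k => ?_⟩
  cases k with
  | zero => simpa using hB0
  | succ k =>
    rw [PowerSeries.coeff_succ_X_mul, pow_succ]
    have := hB k
    nlinarith [mul_nonneg hB0 (pow_nonneg (by norm_num : (0 : ℝ) ≤ 3 / 4) k)]

theorem Decays.C_mul {g : ℝ⟦X⟧} (h : Decays g) (r : ℝ) : Decays (C r * g) := by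
  obtain ⟨B, hB⟩ := h
  refine ⟨|r| * B, fun k => ?_⟩
  rw [PowerSeries.coeff_C_mul, abs_mul, mul_assoc]
  exact mul_le_mul_of_nonneg_left (hB k) (abs_nonneg _)

theorem Decays.add {f g : ℝ⟦X⟧} (hf : Decays f) (hg : Decays g) : Decays (f + g) := by
  obtain ⟨A, hA⟩ := hf
  obtain ⟨B, hB⟩ := hg
  refine ⟨A + B, fun k => ?_⟩
  rw [map_add, add_mul]
  exact (abs_add_le _ _).trans (add_le_add (hA k) (hB k))

theorem decays_one : Decays 1 := by
  refine ⟨1, fun k => ?_⟩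
  rw [PowerSeries.coeff_one]
  split_ifs with h
  · simp [h]
  · simp only [abs_zero]; positivity

/-- Solving (2 + X) r = g coefficient by coefficient gives rₖ₊₁ = (gₖ₊₁ - rₖ)/2; the bound 2B (3/4)ᵏ
propagates since 3/8 + 1 ≤ 3/2. -/
theorem Decays.recip_mul {g : ℝ⟦X⟧} (h : Decays g) : Decays (recip * g) := by
  obtain ⟨B, hB⟩ := h
  have hB0 := Decays.nonneg hB
  have hg : (C 2 + X) * (recip * g) = g := by rw [← mul_assoc, mul_recip, one_mul]
  refine ⟨2 * B, fun k => ?_⟩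
  induction k with
  | zero =>
    have h1 := coeff_zero_two_add_mul (recip * g)
    rw [hg] at h1
    have h2 := hB 0
    rw [h1, abs_mul, abs_two] at h2
    simp only [pow_zero, mul_one] at h2 ⊢
    linarith
  | succ k ih =>
    have h1 := coeff_succ_two_add_mul (recip * g) k
    rw [hg] at h1
    have h2 := hB (k + 1)
    have h3 : PowerSeries.coeff (k + 1) (recip * g) =
      (PowerSeries.coeff (k + 1) g - PowerSeries.coeff k (recip * g)) / 2 := by linarith
    rw [h3, abs_div, abs_two]
    have h4 := abs_sub (PowerSeries.coeff (k + 1) g) (PowerSeries.coeff k (recip * g))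
    rw [pow_succ] at h2 ⊢
    have := mul_nonneg hB0 (pow_nonneg (by norm_num : (0 : ℝ) ≤ 3 / 4) k)
    rw [div_le_iff₀ two_pos]
    nlinarith

theorem Decays.autSeries_mul {g : ℝ⟦X⟧} (h : Decays g) : Decays (autSeries * g) := by
  have : autSeries * g = recip * (g + C 2 * (X * g)) := by unfold autSeries; ring
  rw [this]
  exact (h.add (h.X_mul.C_mul 2)).recip_mul

theorem Decays.autSeries_pow_mul {g : ℝ⟦X⟧} (h : Decays g) (n : ℕ) :
    Decays (autSeries ^ n * g) := by
  induction n with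
  | zero => simpa using h
  | succ n ih => rw [pow_succ', mul_assoc]; exact ih.autSeries_mul

theorem Decays.summable_sq {g : ℝ⟦X⟧} (h : Decays g) :
    Summable fun k => (PowerSeries.coeff k g) ^ 2 := by
  obtain ⟨B, hB⟩ := h
  have hs : Summable fun k : ℕ => B ^ 2 * ((3 / 4 : ℝ) ^ 2) ^ k :=
    (summable_geometric_of_lt_one (by norm_num) (by norm_num)).mul_left _
  refine hs.of_nonneg_of_le (fun k => sq_nonneg _) fun k => ?_
  calc (PowerSeries.coeff k g) ^ 2 = |PowerSeries.coeff k g| ^ 2 := (sq_abs _).symm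
    _ ≤ (B * (3 / 4 : ℝ) ^ k) ^ 2 := pow_le_pow_left₀ (abs_nonneg _) (hB k) 2
    _ = _ := by rw [mul_pow, ← pow_mul, ← pow_mul, mul_comm 2 k]

/-- T is inner: |2 + z|² - |1 + 2z|² = 3(1 - |z|²). On coefficients of r = g/(2 + X), this becomes a
telescoping sum. -/
theorem Decays.sqNorm_autSeries_mul {g : ℝ⟦X⟧} (h : Decays g) :
    sqNorm (autSeries * g) = sqNorm g := by
  have hd := h.recip_mul
  set r := recip * g with hr
  have h1 : autSeries * g = (1 + C 2 * X) * r := by rw [hr]; unfold autSeries; ring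
  have h2 : g = (C 2 + X) * r := by rw [hr, ← mul_assoc, mul_recip, one_mul]
  have s := hd.summable_sq
  have s' := (summable_nat_add_iff 1).2 s
  have e1 := h.autSeries_mul.summable_sq.tsum_eq_zero_add
  have e2 := h.summable_sq.tsum_eq_zero_add
  have e3 := s.tsum_eq_zero_add
  have t1 := (summable_nat_add_iff 1).2 h.autSeries_mul.summable_sq
  have t2 := (summable_nat_add_iff 1).2 h.summable_sq
  have key : ∑' k, ((PowerSeries.coeff (k + 1) g) ^ 2
      - (PowerSeries.coeff (k + 1) (autSeries * g)) ^ 2) =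
      ∑' k, (3 * (PowerSeries.coeff (k + 1) r) ^ 2 - 3 * (PowerSeries.coeff k r) ^ 2) := by
    refine tsum_congr fun k => ?_
    rw [h1]
    conv_lhs => rw [h2]
    rw [coeff_succ_two_add_mul, coeff_succ_one_add_mul]
    ring
  rw [t2.tsum_sub t1, (s'.mul_left 3).tsum_sub (s.mul_left 3), tsum_mul_left, tsum_mul_left] at key
  have z1 : PowerSeries.coeff 0 (autSeries * g) = PowerSeries.coeff 0 r := by
    rw [h1, coeff_zero_one_add_mul]
  have z2 : PowerSeries.coeff 0 g = 2 * PowerSeries.coeff 0 r := by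
    conv_lhs => rw [h2]
    rw [coeff_zero_two_add_mul]
  unfold sqNorm
  rw [e1, e2, z1, z2]
  nlinarith

theorem Decays.sqNorm_autSeries_pow_mul {g : ℝ⟦X⟧} (h : Decays g) (n : ℕ) :
    sqNorm (autSeries ^ n * g) = sqNorm g := by
  induction n with
  | zero => simp
  | succ n ih => rw [pow_succ', mul_assoc, (h.autSeries_pow_mul n).sqNorm_autSeries_mul, ih]

theorem decays_autSeries_pow (n : ℕ) : Decays (autSeries ^ n) := by
  simpa using decays_one.autSeries_pow_mul n

theorem summable_autCoeff_sq (n : ℕ) : Summable fun k => autCoeff n k ^ 2 :=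
  (decays_autSeries_pow n).summable_sq

theorem tsum_autCoeff_sq (n : ℕ) : ∑' k, autCoeff n k ^ 2 = 1 := by
  have h := decays_one.sqNorm_autSeries_pow_mul n
  rw [mul_one] at h
  have h1 : sqNorm (1 : ℝ⟦X⟧) = 1 := by
    unfold sqNorm
    rw [tsum_eq_single 0]
    · simp
    · intro k hk; simp [PowerSeries.coeff_one, hk]
  rw [← h1, ← h]; rfl

/-! ### Recurrences for the matrix entries, and Dirichlet symmetry. -/

theorem derivative_autSeries_pow (n : ℕ) :
    d⁄dX ℝ (autSeries ^ (n + 1)) = C (3 * (n + 1) : ℝ) * (autSeries ^ n * recip ^ 2) := by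
  rw [Derivation.leibniz_pow, derivative_autSeries, map_mul, C_ofNat, map_add, map_natCast,
    map_one, smul_eq_mul, nsmul_eq_mul]
  rw [Nat.add_sub_cancel]
  push_cast
  ring

/-- Follows from T' = 3/(2 + z)²; comparing coefficients yields the three-term recurrence in k. -/
theorem autSeries_pow_ode (n : ℕ) :
    (C 2 + X) * ((1 + C 2 * X) * d⁄dX ℝ (autSeries ^ n)) = C (3 * n : ℝ) * autSeries ^ n := by
  cases n with
  | zero => simp
  | succ n =>
    rw [derivative_autSeries_pow]
    have h1 := mul_recip
    have h2 := mul_autSeries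
    push_cast
    rw [← h2, pow_succ]
    linear_combination
      (C (3 * (n + 1) : ℝ) * autSeries ^ n * autSeries * ((C 2 + X) * recip + 1)) * h1

theorem coeff_derivative_autSeries_pow (n k : ℕ) :
    PowerSeries.coeff k (d⁄dX ℝ (autSeries ^ n)) = autCoeff n (k + 1) * (k + 1) :=
  PowerSeries.coeff_derivative _ _

theorem autCoeff_recurrence_zero (n : ℕ) : 2 * autCoeff n 1 = 3 * n * autCoeff n 0 := by
  have h := congrArg (PowerSeries.coeff 0) (autSeries_pow_ode n)
  rw [coeff_zero_two_add_mul, coeff_zero_one_add_mul, PowerSeries.coeff_C_mul,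
    coeff_derivative_autSeries_pow] at h
  change _ = 3 * (n : ℝ) * autCoeff n 0 at h
  simpa using h

theorem autCoeff_recurrence (n k : ℕ) :
    2 * ((k + 2) * autCoeff n (k + 2)) + 5 * ((k + 1) * autCoeff n (k + 1)) +
      2 * (k * autCoeff n k) = 3 * n * autCoeff n (k + 1) := by
  have h := congrArg (PowerSeries.coeff (k + 1)) (autSeries_pow_ode n)
  cases k with
  | zero =>
    rw [coeff_succ_two_add_mul, coeff_succ_one_add_mul, coeff_zero_one_add_mul,
      PowerSeries.coeff_C_mul] at h
    simp only [coeff_derivative_autSeries_pow] at h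
    change _ = 3 * (n : ℝ) * autCoeff n (0 + 1) at h
    push_cast at h ⊢
    simp only [zero_add] at h ⊢
    linarith
  | succ k =>
    rw [coeff_succ_two_add_mul, coeff_succ_one_add_mul, coeff_succ_one_add_mul,
      PowerSeries.coeff_C_mul] at h
    simp only [coeff_derivative_autSeries_pow] at h
    change _ = 3 * (n : ℝ) * autCoeff n (k + 1 + 1) at h
    push_cast at h ⊢
    linarith

theorem autCoeff_pascal_zero (n : ℕ) : 2 * autCoeff (n + 1) 0 = autCoeff n 0 := by
  have h : (C 2 + X) * autSeries ^ (n + 1) = (1 + C 2 * X) * autSeries ^ n := by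
    rw [pow_succ]; linear_combination autSeries ^ n * mul_autSeries
  have h := congrArg (PowerSeries.coeff 0) h
  rwa [coeff_zero_two_add_mul, coeff_zero_one_add_mul] at h

theorem autCoeff_pascal (n k : ℕ) :
    2 * autCoeff (n + 1) (k + 1) + autCoeff (n + 1) k =
      autCoeff n (k + 1) + 2 * autCoeff n k := by
  have h : (C 2 + X) * autSeries ^ (n + 1) = (1 + C 2 * X) * autSeries ^ n := by
    rw [pow_succ]; linear_combination autSeries ^ n * mul_autSeries
  have h := congrArg (PowerSeries.coeff (k + 1)) h
  rwa [coeff_succ_two_add_mul, coeff_succ_one_add_mul] at h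

theorem autCoeff_zero_left (k : ℕ) : autCoeff 0 k = if k = 0 then 1 else 0 := by
  simp [autCoeff, PowerSeries.coeff_one]

theorem autCoeff_zero_right (n : ℕ) : autCoeff n 0 = (1 / 2) ^ n := by
  induction n with
  | zero => simp [autCoeff_zero_left]
  | succ n ih =>
    have := autCoeff_pascal_zero n
    rw [pow_succ, ← ih]; linarith

/-- Coefficientwise form of `(z² - 1) (Tⁿ)' = n (Tⁿ⁺¹ - Tⁿ⁻¹)`. -/
theorem autCoeff_mixed (n m : ℕ) :
    m * autCoeff (n + 1) m - (m + 2) * autCoeff (n + 1) (m + 2) =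
      (n + 1) * (autCoeff (n + 2) (m + 1) - autCoeff n (m + 1)) := by
  have h : (X * (X * d⁄dX ℝ (autSeries ^ (n + 1))) - d⁄dX ℝ (autSeries ^ (n + 1)) : ℝ⟦X⟧) =
      C (n + 1 : ℝ) * (autSeries ^ (n + 2) - autSeries ^ n) := by
    rw [derivative_autSeries_pow, map_mul, map_add, map_one, map_natCast, pow_add]
    have h1 := mul_recip
    unfold autSeries
    simp only [C_ofNat] at h1 ⊢
    set A := ((1 + 2 * X) * recip) ^ n
    linear_combination -(n + 1 : ℝ⟦X⟧) * A * ((2 + X) * recip + 1) * h1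
  have h := congrArg (PowerSeries.coeff (m + 1)) h
  rw [map_sub, PowerSeries.coeff_C_mul, map_sub, PowerSeries.coeff_succ_X_mul,
    coeff_derivative_autSeries_pow] at h
  change _ = (n + 1 : ℝ) * (autCoeff (n + 2) (m + 1) - autCoeff n (m + 1)) at h
  rw [← h]
  cases m with
  | zero => simp [PowerSeries.coeff_zero_X_mul]; ring
  | succ m =>
    rw [PowerSeries.coeff_succ_X_mul, coeff_derivative_autSeries_pow]
    push_cast; ring

theorem autCoeff_one_left (m : ℕ) : autCoeff 1 (m + 1) = 3 / 4 * (-1 / 2) ^ m := by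
  induction m with
  | zero =>
    have h1 := autCoeff_recurrence_zero 1
    rw [autCoeff_zero_right] at h1
    norm_num at h1 ⊢
    linarith
  | succ m ih =>
    have := autCoeff_pascal 0 (m + 1)
    rw [autCoeff_zero_left, autCoeff_zero_left] at this
    simp only [Nat.add_eq_zero_iff, one_ne_zero, and_false, if_false, zero_add] at this
    rw [pow_succ]; linarith

/-- Unitarity of composition with the automorphism on the Dirichlet space. -/
theorem autCoeff_symm (n m : ℕ) :
    (-1) ^ m * ((m + 1) * autCoeff (n + 1) (m + 1)) =
      (-1) ^ n * ((n + 1) * autCoeff (m + 1) (n + 1)) := by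
  have base : ∀ m : ℕ, (-1) ^ m * ((m + 1) * autCoeff 1 (m + 1)) = autCoeff (m + 1) 1 := by
    intro m
    have h := autCoeff_recurrence_zero (m + 1)
    rw [autCoeff_zero_right] at h
    rw [autCoeff_one_left]
    have : ((-1 : ℝ)) ^ m * (-1 / 2) ^ m = (1 / 2) ^ m := by rw [← mul_pow]; norm_num
    push_cast at h
    rw [pow_succ] at h
    linear_combination (3 / 4 * (m + 1 : ℝ)) * this - h / 2
  induction n using Nat.strong_induction_on generalizing m with
  | _ n ih =>
    match n with
    | 0 => simpa using base m
    | n + 1 =>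
      have e1 := autCoeff_mixed n m
      have e2 := autCoeff_mixed m n
      have i1 := ih n (by omega) (m + 1)
      -- The two mixed identities, at (n, m) and (m, n), are transposes of each other up to sign.
      -- Symmetry for first indices n and n + 1 matches all terms but the wanted one; the boundary
      -- cases m = 0 and n = 0 vanish.
      have hm : (m : ℝ) * autCoeff (n + 1) m * (-1) ^ m =
          - ((-1) ^ n * ((n + 1) * autCoeff m (n + 1))) := by
        cases m with
        | zero => simp [autCoeff_zero_left]
        | succ m =>
          have := ih n (by omega) m
          push_cast
          rw [← this, pow_succ]; ring
      have hn : (n : ℝ) * autCoeff (m + 1) n * (-1) ^ n =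
          - ((-1) ^ m * ((m + 1) * autCoeff n (m + 1))) := by
        cases n with
        | zero => simp [autCoeff_zero_left]
        | succ n =>
          have := ih n (by omega) m
          push_cast
          rw [this, pow_succ]; ring
      push_cast at i1 ⊢
      have hne : (n + 1 : ℝ) ≠ 0 := by positivity
      apply mul_left_cancel₀ hne
      rw [pow_succ] at i1 ⊢
      linear_combination (-1) ^ m * (m + 1 : ℝ) * (-e1) + (m + 1 : ℝ) * hm +
        (m + 1 : ℝ) * i1 - (-1) ^ n * (n + 1 : ℝ) * e2 + (n + 1 : ℝ) * hn

theorem abs_autCoeff_symm {n m : ℕ} (hn : 1 ≤ n) (hm : 1 ≤ m) :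
    m * |autCoeff n m| = n * |autCoeff m n| := by
  obtain ⟨n, rfl⟩ := Nat.exists_eq_add_of_le' hn
  obtain ⟨m, rfl⟩ := Nat.exists_eq_add_of_le' hm
  have h := congrArg abs (autCoeff_symm n m)
  have p : ∀ k : ℕ, |(k : ℝ) + 1| = k + 1 := fun k => abs_of_pos (by positivity)
  simp only [abs_mul, abs_pow, abs_neg, abs_one, one_pow, one_mul, p] at h
  exact_mod_cast h

/-! ### Mass in the oscillatory region. -/

/-- The weight (4k)² - (3n - 5k)² is the discriminant of the recurrence, positive exactly for n/3 <
k < 3n. The sum equals 4‖(1 - z²)(Tⁿ)'‖². Dropping the isometric factor Tⁿ⁻¹ leaves 3n(1 - z²)/(2 +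
z)², whose constant coefficient is 3n/4. -/
theorem tsum_discriminant_ge (n : ℕ) (hn : 1 ≤ n) :
    (Summable fun k : ℕ => 3 * (3 * k - n : ℝ) * (3 * n - k) * autCoeff n k ^ 2) ∧
    9 / 4 * (n : ℝ) ^ 2 ≤ ∑' k : ℕ, 3 * (3 * k - n : ℝ) * (3 * n - k) * autCoeff n k ^ 2 := by
  obtain ⟨n, rfl⟩ := Nat.exists_eq_add_of_le' hn
  set u : ℕ → ℝ := fun k => k * autCoeff (n + 1) k with hu
  set W : ℝ⟦X⟧ := d⁄dX ℝ (autSeries ^ (n + 1)) with hW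
  have hWc : ∀ k, PowerSeries.coeff k W = u (k + 1) := fun k => by
    rw [hW, coeff_derivative_autSeries_pow]; simp only [hu]; push_cast; ring
  have hWd : Decays W := by
    rw [hW, derivative_autSeries_pow]
    refine Decays.C_mul (Decays.autSeries_pow_mul ?_ n) _
    simpa [sq] using decays_one.recip_mul.recip_mul
  set V : ℝ⟦X⟧ := W + C (-1) * (X * (X * W)) with hV
  have hVd : Decays V := hWd.add ((hWd.X_mul.X_mul).C_mul _)
  have hV0 : PowerSeries.coeff 0 V = u 1 := by
    simp only [hV, map_add, PowerSeries.coeff_C_mul, PowerSeries.coeff_zero_X_mul, hWc]; simp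
  have hV1 : ∀ k, PowerSeries.coeff (k + 1) V = u (k + 2) - u k := by
    intro k
    cases k with
    | zero => simp [hV, hWc, hu, PowerSeries.coeff_succ_X_mul]
    | succ k =>
      simp only [hV, map_add, PowerSeries.coeff_C_mul, PowerSeries.coeff_succ_X_mul, hWc]; ring
  have hVn : 9 * (n + 1 : ℝ) ^ 2 / 16 ≤ sqNorm V := by
    have hd : Decays (C (3 * (n + 1) : ℝ) * (recip * (recip * (1 + C (-1) * (X * (X * 1)))))) :=
      (decays_one.add ((decays_one.X_mul.X_mul).C_mul _)).recip_mul.recip_mul.C_mul _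
    have hfac : V = autSeries ^ n *
        (C (3 * (n + 1) : ℝ) * (recip * (recip * (1 + C (-1) * (X * (X * 1)))))) := by
      rw [hV, hW, derivative_autSeries_pow]; ring
    rw [hfac, hd.sqNorm_autSeries_pow_mul]
    refine le_trans (le_of_eq ?_) (hd.summable_sq.le_tsum 0 fun k _ => sq_nonneg _)
    have : PowerSeries.constantCoeff recip = 1 / 2 := by simp [recip]
    simp [this]; ring
  have hs := hWd.summable_sq
  simp only [hWc] at hs
  have hs0 : Summable fun k => u k ^ 2 := (summable_nat_add_iff 1).1 hs
  have hs2 : Summable fun k => u (k + 2) ^ 2 := (summable_nat_add_iff 2).2 hs0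
  have hv := hVd.summable_sq
  have hv1 : Summable fun k => (u (k + 2) - u k) ^ 2 := by
    have := (summable_nat_add_iff 1).2 hv
    simpa only [hV1] using this
  have hterm : ∀ k : ℕ, 3 * (3 * (k + 1 : ℕ) - (n + 1 : ℕ) : ℝ) * (3 * (n + 1 : ℕ) - (k + 1 : ℕ)) *
      autCoeff (n + 1) (k + 1) ^ 2 =
      16 * u (k + 1) ^ 2 + (4 * (u (k + 2) - u k) ^ 2 + (- 8 * u (k + 2) ^ 2 + - 8 * u k ^ 2)) := by
    intro k
    have hr := autCoeff_recurrence (n + 1) k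
    simp only [hu]
    push_cast at hr ⊢
    linear_combination
      (-(3 * (n + 1 : ℝ) * autCoeff (n + 1) (k + 1)) + 5 * ((k + 1) * autCoeff (n + 1) (k + 1))
       - 2 * ((k + 2) * autCoeff (n + 1) (k + 2)) - 2 * (k * autCoeff (n + 1) k)) * hr * (-1)
  have ha := hs.mul_left 16
  have hb := hv1.mul_left 4
  have hc := hs2.mul_left (-8)
  have hd := hs0.mul_left (-8)
  have hS : Summable fun k : ℕ => 3 * (3 * k - (n + 1 : ℕ) : ℝ) * (3 * (n + 1 : ℕ) - k) *
      autCoeff (n + 1) k ^ 2 := by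
    refine (summable_nat_add_iff 1).1 ?_
    simp only [hterm]
    exact ha.add (hb.add (hc.add hd))
  refine ⟨hS, ?_⟩
  rw [hS.tsum_eq_zero_add]
  simp only [hterm]
  rw [ha.tsum_add (hb.add (hc.add hd)), hb.tsum_add (hc.add hd), hc.tsum_add hd, tsum_mul_left,
    tsum_mul_left, tsum_mul_left, tsum_mul_left]
  have e0 := hs0.tsum_eq_zero_add
  have e1 := hs.tsum_eq_zero_add
  have ev := hv.tsum_eq_zero_add
  simp only [hV0, hV1] at ev
  unfold sqNorm at hVn
  rw [ev] at hVn
  have hu0 : u 0 = 0 := by simp [hu]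
  rw [hu0] at e0
  -- The boundary terms cancel: -4u₁² from index 0, 8u₁² from the shifted sums, -4u₁² from the
  -- constant coefficient of V.
  have hr0 := autCoeff_recurrence_zero (n + 1)
  have hu1 : u 1 = autCoeff (n + 1) 1 := by simp [hu]
  have h0 : 2 * u 1 = 3 * (n + 1) * autCoeff (n + 1) 0 := by rw [hu1, hr0]; push_cast; ring
  have h00 : (2 * u 1) ^ 2 = 9 * (n + 1) ^ 2 * autCoeff (n + 1) 0 ^ 2 := by rw [h0]; ring
  simp only [zero_add, Nat.reduceAdd, add_assoc] at e1 e0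
  push_cast
  nlinarith


/-! ### Almost conserved energy of the recurrence. -/

/-- The cosine of the local phase shift in the recurrence for `k * autCoeff n k`. -/
noncomputable def phaseCos (n k : ℕ) : ℝ := (3 * n - 5 * k) / (4 * k)

/-- The Taylor coefficients of `z * (Tⁿ)'`. -/
noncomputable def eulerCoeff (n k : ℕ) : ℝ := k * autCoeff n k

/-- The (almost conserved) energy of the recurrence for `eulerCoeff n`. -/
noncomputable def energy (n k : ℕ) : ℝ :=
  eulerCoeff n k ^ 2 + eulerCoeff n (k + 1) ^ 2 -
    2 * phaseCos n k * eulerCoeff n k * eulerCoeff n (k + 1)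

/-- The indices `k` well inside the oscillatory region `(n / 3, 3 * n)`. -/
def InBulk (n k : ℕ) : Prop := 2 * n ≤ 5 * k ∧ 20 * k ≤ 59 * n

theorem eulerCoeff_recurrence (n k : ℕ) :
    eulerCoeff n (k + 2) = 2 * phaseCos n (k + 1) * eulerCoeff n (k + 1) - eulerCoeff n k := by
  have h := autCoeff_recurrence n k
  have hk : ((k : ℝ) + 1) ≠ 0 := by positivity
  unfold eulerCoeff phaseCos
  push_cast
  field_simp
  linear_combination 2 * h

theorem energy_succ (n k : ℕ) : energy n (k + 1) =
    eulerCoeff n k ^ 2 + eulerCoeff n (k + 1) ^ 2 -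
      2 * phaseCos n (k + 1) * eulerCoeff n k * eulerCoeff n (k + 1) := by
  unfold energy
  rw [eulerCoeff_recurrence]; ring

theorem InBulk.pos {n k : ℕ} (hn : 1 ≤ n) (h : InBulk n k) : 1 ≤ k := by
  unfold InBulk at h; omega

theorem InBulk.abs_phaseCos_le {n k : ℕ} (hn : 1 ≤ n) (h : InBulk n k) :
    |phaseCos n k| ≤ 1 - 1 / 288 := by
  have hk : (1 : ℝ) ≤ k := by exact_mod_cast h.pos hn
  have h1 : (2 : ℝ) * n ≤ 5 * k := by exact_mod_cast h.1
  have h2 : (20 : ℝ) * k ≤ 59 * n := by exact_mod_cast h.2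
  unfold phaseCos
  rw [abs_le, le_div_iff₀ (by positivity), div_le_iff₀ (by positivity)]
  constructor <;> nlinarith

theorem quadratic_ge {x s u v : ℝ} (h : |x| ≤ 1 - s) :
    s * (u ^ 2 + v ^ 2) ≤ u ^ 2 + v ^ 2 - 2 * x * u * v := by
  obtain ⟨h1, h2⟩ := abs_le.1 h
  nlinarith [mul_nonneg (sub_nonneg.2 h2) (sq_nonneg (u + v)),
    mul_nonneg (by linarith : 0 ≤ x + (1 - s)) (sq_nonneg (u - v))]

theorem InBulk.energy_ge {n k : ℕ} (hn : 1 ≤ n) (h : InBulk n k) :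
    eulerCoeff n k ^ 2 + eulerCoeff n (k + 1) ^ 2 ≤ 288 * energy n k := by
  have := quadratic_ge (u := eulerCoeff n k) (v := eulerCoeff n (k + 1)) (h.abs_phaseCos_le hn)
  unfold energy; linarith

theorem InBulk.energy_nonneg {n k : ℕ} (hn : 1 ≤ n) (h : InBulk n k) : 0 ≤ energy n k := by
  nlinarith [h.energy_ge hn, sq_nonneg (eulerCoeff n k), sq_nonneg (eulerCoeff n (k + 1))]

/-- With a constant cosine the energy would be conserved. The change comes only from the cosine's
increment 3n/(4k(k + 1)), at most 5/n because k ≥ 2n/5. -/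
theorem InBulk.energy_diff_le {n k : ℕ} (hn : 1 ≤ n) (h : InBulk n k) :
    |energy n (k + 1) - energy n k| ≤
      5 / n * (eulerCoeff n k ^ 2 + eulerCoeff n (k + 1) ^ 2) := by
  have hk : (1 : ℝ) ≤ k := by exact_mod_cast h.pos hn
  have hn' : (1 : ℝ) ≤ n := by exact_mod_cast hn
  have h1 : (2 : ℝ) * n ≤ 5 * k := by exact_mod_cast h.1
  have e : energy n (k + 1) - energy n k =
      3 * n / (4 * k * (k + 1)) * (2 * eulerCoeff n k * eulerCoeff n (k + 1)) := by
    rw [energy_succ]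
    unfold energy phaseCos
    push_cast
    field_simp
    ring
  rw [e, abs_mul, abs_of_nonneg (by positivity)]
  refine mul_le_mul ?_ ?_ (abs_nonneg _) (by positivity)
  · rw [div_le_div_iff₀ (by positivity) (by positivity)]
    nlinarith
  · rw [abs_le]
    constructor <;> nlinarith [sq_nonneg (eulerCoeff n k + eulerCoeff n (k + 1)),
      sq_nonneg (eulerCoeff n k - eulerCoeff n (k + 1))]

theorem InBulk.energy_succ_le {n k : ℕ} (hn : 1 ≤ n) (h : InBulk n k) :
    energy n (k + 1) ≤ (1 + 1440 / n) * energy n k := by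
  have h1 := (abs_le.1 (h.energy_diff_le hn)).2
  have h2 := mul_le_mul_of_nonneg_left (h.energy_ge hn) (by positivity : (0 : ℝ) ≤ 5 / n)
  have h3 : (5 : ℝ) / n * (288 * energy n k) = 1440 / n * energy n k := by ring
  linarith

theorem InBulk.energy_le_succ {n k : ℕ} (hn : 1 ≤ n) (h : InBulk n k) (h' : InBulk n (k + 1)) :
    energy n k ≤ (1 + 1440 / n) * energy n (k + 1) := by
  have h1 := (abs_le.1 (h.energy_diff_le hn)).1
  have h4 := quadratic_ge (u := eulerCoeff n k) (v := eulerCoeff n (k + 1)) (h'.abs_phaseCos_le hn)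
  rw [← energy_succ] at h4
  have h2 := mul_le_mul_of_nonneg_left
    (by linarith : eulerCoeff n k ^ 2 + eulerCoeff n (k + 1) ^ 2 ≤ 288 * energy n (k + 1))
    (by positivity : (0 : ℝ) ≤ 5 / n)
  have h3 : (5 : ℝ) / n * (288 * energy n (k + 1)) = 1440 / n * energy n (k + 1) := by ring
  linarith

theorem energy_add_comparable {n j i : ℕ} (hn : 1 ≤ n) (h : InBulk n j) (h' : InBulk n (j + i)) :
    energy n (j + i) ≤ (1 + 1440 / n) ^ i * energy n j ∧
    energy n j ≤ (1 + 1440 / n) ^ i * energy n (j + i) := by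
  induction i with
  | zero => simp
  | succ i ih =>
    have hb : InBulk n (j + i) := by unfold InBulk at *; omega
    obtain ⟨h1, h2⟩ := ih hb
    have hp : (0 : ℝ) ≤ 1 + 1440 / n := by positivity
    constructor
    · calc energy n (j + (i + 1)) ≤ (1 + 1440 / n) * energy n (j + i) := hb.energy_succ_le hn
        _ ≤ (1 + 1440 / n) * ((1 + 1440 / n) ^ i * energy n j) := mul_le_mul_of_nonneg_left h1 hp
        _ = _ := by ring
    · calc energy n j ≤ (1 + 1440 / n) ^ i * energy n (j + i) := h2
        _ ≤ (1 + 1440 / n) ^ i * ((1 + 1440 / n) * energy n (j + (i + 1))) :=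
          mul_le_mul_of_nonneg_left (hb.energy_le_succ hn h') (by positivity)
        _ = _ := by ring

/-- At most 3n steps, each costing a factor 1 + 1440/n ≤ exp(1440/n). -/
theorem energy_comparable {n j k : ℕ} (hn : 1 ≤ n) (hj : InBulk n j) (hk : InBulk n k) :
    energy n j ≤ Real.exp 4320 * energy n k := by
  have hn' : (0 : ℝ) < n := by exact_mod_cast hn
  have hpow : ∀ i, i ≤ 3 * n → ((1 : ℝ) + 1440 / n) ^ i ≤ Real.exp 4320 := by
    intro i hi
    have h1 : (1 : ℝ) + 1440 / n ≤ Real.exp (1440 / n) := by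
      rw [add_comm]; exact Real.add_one_le_exp _
    calc ((1 : ℝ) + 1440 / n) ^ i ≤ Real.exp (1440 / n) ^ i :=
          pow_le_pow_left₀ (by positivity) h1 i
      _ = Real.exp (i * (1440 / n)) := (Real.exp_nat_mul _ _).symm
      _ ≤ Real.exp 4320 := by
        refine Real.exp_le_exp.2 ?_
        have : (i : ℝ) ≤ 3 * n := by exact_mod_cast hi
        rw [mul_div_assoc', div_le_iff₀ hn']; linarith
  have h0 := hk.energy_nonneg hn
  rcases le_total j k with h | h <;> obtain ⟨i, rfl⟩ := Nat.exists_eq_add_of_le h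
  · exact (energy_add_comparable hn hj hk).2.trans
      (mul_le_mul_of_nonneg_right (hpow i (by unfold InBulk at *; omega)) h0)
  · exact (energy_add_comparable hn hk hj).1.trans
      (mul_le_mul_of_nonneg_right (hpow i (by unfold InBulk at *; omega)) h0)

/-- Outside the bulk the discriminant is at most 8n²/5, and ∑ a(n,k)² = 1. So the bulk carries at
least (9/4 - 8/5)n² = 13n²/20, spread over at most 3n terms, each bounded by a multiple of the
energy. -/
theorem energy_lower_bound : ∃ c : ℝ, 0 < c ∧ ∀ n k : ℕ, 1 ≤ n → InBulk n k →
    c * n ≤ energy n k := by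
  refine ⟨(13 / 20) / (86400 * Real.exp 4320), by positivity, fun n k hn hk => ?_⟩
  have hn' : (0 : ℝ) < n := by exact_mod_cast hn
  have hE := hk.energy_nonneg hn
  obtain ⟨hs, hge⟩ := tsum_discriminant_ge n hn
  set M := 28800 * Real.exp 4320 * energy n k with hM
  have hM0 : 0 ≤ M := by positivity
  have hbulk : ∀ j, InBulk n j → 16 * n ^ 2 * autCoeff n j ^ 2 ≤ M := by
    intro j hj
    have hj1 : (0 : ℝ) < j := by exact_mod_cast hj.pos hn
    have h1 : (2 : ℝ) * n ≤ 5 * j := by exact_mod_cast hj.1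
    have h2 := hj.energy_ge hn
    have h3 := energy_comparable hn hj hk
    have h4 : (n : ℝ) ^ 2 * autCoeff n j ^ 2 ≤ 25 / 4 * eulerCoeff n j ^ 2 := by
      unfold eulerCoeff
      rw [mul_pow]
      have : (n : ℝ) ^ 2 ≤ 25 / 4 * j ^ 2 := by nlinarith
      nlinarith [mul_le_mul_of_nonneg_right this (sq_nonneg (autCoeff n j))]
    have h5 := sq_nonneg (eulerCoeff n (j + 1))
    rw [hM]
    linarith
  have hle : ∀ j : ℕ, 3 * (3 * j - n : ℝ) * (3 * n - j) * autCoeff n j ^ 2 ≤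
      8 / 5 * n ^ 2 * autCoeff n j ^ 2 + if j ∈ Finset.range (3 * n) then M else 0 := by
    intro j
    have hif : (0 : ℝ) ≤ if j ∈ Finset.range (3 * n) then M else 0 := by
      split_ifs <;> simp [hM0]
    by_cases hj : InBulk n j
    · have hr : j ∈ Finset.range (3 * n) := by
        unfold InBulk at hj; rw [Finset.mem_range]; omega
      rw [if_pos hr]
      have hD : 3 * (3 * j - n : ℝ) * (3 * n - j) ≤ 16 * n ^ 2 := by
        nlinarith [sq_nonneg (3 * (j : ℝ) - 5 * n)]
      have := mul_le_mul_of_nonneg_right hD (sq_nonneg (autCoeff n j))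
      have h2 : 0 ≤ 8 / 5 * (n : ℝ) ^ 2 * autCoeff n j ^ 2 := by positivity
      linarith [hbulk j hj]
    · have hD : 3 * (3 * j - n : ℝ) * (3 * n - j) ≤ 8 / 5 * n ^ 2 := by
        unfold InBulk at hj
        rcases not_and_or.1 hj with h | h
        · have h : (5 : ℝ) * j ≤ 2 * n := by exact_mod_cast (not_le.1 h).le
          nlinarith [(Nat.cast_nonneg j : (0 : ℝ) ≤ j)]
        · have h : (59 : ℝ) * n ≤ 20 * j := by exact_mod_cast (not_le.1 h).le
          nlinarith [(Nat.cast_nonneg j : (0 : ℝ) ≤ j)]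
      have := mul_le_mul_of_nonneg_right hD (sq_nonneg (autCoeff n j))
      linarith
  have hfin : HasSum (fun j : ℕ => if j ∈ Finset.range (3 * n) then M else 0) (3 * n * M) := by
    have : HasSum (fun j : ℕ => if j ∈ Finset.range (3 * n) then M else 0)
        (∑ j ∈ Finset.range (3 * n), if j ∈ Finset.range (3 * n) then M else 0) :=
      hasSum_sum_of_ne_finset_zero fun j hj => if_neg hj
    rw [Finset.sum_ite_mem, Finset.inter_self, Finset.sum_const, Finset.card_range,
      nsmul_eq_mul] at this
    exact_mod_cast this
  have hsq := (summable_autCoeff_sq n).mul_left (8 / 5 * (n : ℝ) ^ 2)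
  have h1 := Summable.tsum_le_tsum hle hs (hsq.add hfin.summable)
  rw [hsq.tsum_add hfin.summable, tsum_mul_left, tsum_autCoeff_sq, hfin.tsum_eq] at h1
  have h2 : 13 / 20 * (n : ℝ) ^ 2 ≤ 3 * n * M := by linarith
  have h3 : 13 / 20 * (n : ℝ) ≤ 3 * M := by nlinarith
  rw [div_mul_eq_mul_div, div_le_iff₀ (by positivity)]
  rw [hM] at h3
  linarith

/-! ### Simultaneously large coefficients for two exponents. -/

/-- Among three consecutive coefficients in the window `[n, 5 n / 2]`, at most one is small. -/
theorem at_most_one_small : ∃ c : ℝ, 0 < c ∧ ∀ n k : ℕ, 1 ≤ n → n ≤ k → 2 * (k + 1) ≤ 5 * n →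
    (c * √n ≤ |eulerCoeff n k| ∨ c * √n ≤ |eulerCoeff n (k + 1)|) ∧
    (c * √n ≤ |eulerCoeff n (k + 1)| ∨ c * √n ≤ |eulerCoeff n (k + 2)|) ∧
    (c * √n ≤ |eulerCoeff n k| ∨ c * √n ≤ |eulerCoeff n (k + 2)|) := by
  obtain ⟨c, hc, h⟩ := energy_lower_bound
  refine ⟨√(c / 6), by positivity, fun n k hn hk1 hk2 => ?_⟩
  have hn' : (0 : ℝ) < n := by exact_mod_cast hn
  set t := √(c / 6) * √n with ht
  have ht2 : 6 * t ^ 2 = c * n := by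
    rw [ht, mul_pow, Real.sq_sqrt (by positivity), Real.sq_sqrt hn'.le]; ring
  have htp : 0 < t := by positivity
  have b0 : InBulk n k := by unfold InBulk; omega
  have b1 : InBulk n (k + 1) := by unfold InBulk; omega
  have e0 := h n k hn b0
  have e1 := h n (k + 1) hn b1
  have x0 := abs_le.1 (b0.abs_phaseCos_le hn)
  have x1 := abs_le.1 (b1.abs_phaseCos_le hn)
  have pair : ∀ x u v : ℝ, -(1 - 1 / 288) ≤ x ∧ x ≤ 1 - 1 / 288 →
      c * n ≤ u ^ 2 + v ^ 2 - 2 * x * u * v → t ≤ |u| ∨ t ≤ |v| := by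
    intro x u v hx hE
    by_contra! hcon
    have hu := sq_lt_sq' (abs_lt.1 hcon.1).1 (abs_lt.1 hcon.1).2
    have hv := sq_lt_sq' (abs_lt.1 hcon.2).1 (abs_lt.1 hcon.2).2
    nlinarith [mul_nonneg (by linarith : 0 ≤ 1 + x) (sq_nonneg (u - v)),
      mul_nonneg (by linarith : 0 ≤ 1 - x) (sq_nonneg (u + v))]
  refine ⟨pair _ _ _ x0 e0, pair _ _ _ x1 e1, ?_⟩
  by_contra! hcon
  -- For k ≥ n the cosine is at most -1/2, so u + w = 2xv gives |v| ≤ |u + w|. Small u and w would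
  -- make v small too, and the energy v² - uw less than 6t².
  have hx : phaseCos n (k + 1) ≤ -1 / 2 := by
    unfold phaseCos
    rw [div_le_iff₀ (by positivity)]
    have : (n : ℝ) ≤ k := by exact_mod_cast hk1
    push_cast
    linarith
  have hr := eulerCoeff_recurrence n k
  rw [energy_succ] at e1
  set u := eulerCoeff n k
  set v := eulerCoeff n (k + 1)
  set w := eulerCoeff n (k + 2)
  set x := phaseCos n (k + 1)
  obtain ⟨⟨u1, u2⟩, w1, w2⟩ := And.intro (abs_lt.1 hcon.1) (abs_lt.1 hcon.2)
  have hv : v ^ 2 ≤ (u + w) ^ 2 := by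
    have : u + w = 2 * x * v := by linarith
    rw [this]
    nlinarith [mul_nonneg (by nlinarith : 0 ≤ 4 * x ^ 2 - 1) (sq_nonneg v)]
  have huw : (u + w) ^ 2 ≤ 4 * t ^ 2 := by nlinarith
  have hE : u ^ 2 + v ^ 2 - 2 * x * u * v = v ^ 2 - u * w := by rw [hr]; ring
  have hprod : - (u * w) ≤ t ^ 2 := by nlinarith
  nlinarith

/-- Pigeonhole: each sequence excludes at most one of three indices. -/
theorem exists_common_large : ∃ c : ℝ, 0 < c ∧ ∀ n m k : ℕ, 1 ≤ n → 1 ≤ m → n ≤ k → m ≤ k →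
    2 * (k + 1) ≤ 5 * n → 2 * (k + 1) ≤ 5 * m →
    ∃ j, k ≤ j ∧ j ≤ k + 2 ∧ c * √n ≤ |eulerCoeff n j| ∧ c * √m ≤ |eulerCoeff m j| := by
  obtain ⟨c, hc, h⟩ := at_most_one_small
  refine ⟨c, hc, fun n m k hn hm hnk hmk hn' hm' => ?_⟩
  obtain ⟨a1, a2, a3⟩ := h n k hn hnk hn'
  obtain ⟨b1, b2, b3⟩ := h m k hm hmk hm'
  by_cases p0 : c * √n ≤ |eulerCoeff n k| ∧ c * √m ≤ |eulerCoeff m k|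
  · exact ⟨k, le_rfl, by omega, p0⟩
  by_cases p1 : c * √n ≤ |eulerCoeff n (k + 1)| ∧ c * √m ≤ |eulerCoeff m (k + 1)|
  · exact ⟨k + 1, by omega, by omega, p1⟩
  refine ⟨k + 2, by omega, le_rfl, ?_⟩
  tauto

/-- The absolute values of the `(m, n)` entry of the square of the composition matrix add up to
something bounded below. -/
theorem sum_abs_mul_abs_ge : ∃ c : ℝ, 0 < c ∧ ∀ n m : ℕ, 16 ≤ n → 16 ≤ m → n ≤ 2 * m → m ≤ 2 * n →
    c ≤ ∑ k ∈ Finset.range (3 * n), |autCoeff n k| * |autCoeff k m| := by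
  obtain ⟨c, hc, h⟩ := exists_common_large
  -- At least n/20 triples each contribute c²/(6n), and each index lies in at most three triples.
  refine ⟨c ^ 2 / 360, by positivity, fun n m hn hm hnm hmn => ?_⟩
  set P : ℕ → ℝ := fun k => |autCoeff n k| * |autCoeff k m| with hP
  have hP0 : ∀ k, 0 ≤ P k := fun k => by positivity
  have hn' : (0 : ℝ) < n := by exact_mod_cast (by omega : 0 < n)
  have hm' : (0 : ℝ) < m := by exact_mod_cast (by omega : 0 < m)
  set a := max n m
  set b := (5 * min n m) / 2 - 1
  have hPlow : ∀ j, a ≤ j → j ≤ b + 2 → c * √n ≤ |eulerCoeff n j| → c * √m ≤ |eulerCoeff m j| →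
      c ^ 2 / (6 * n) ≤ P j := by
    intro j hj1 hj2 h1 h2
    have hj : 1 ≤ j := by omega
    have hj' : (0 : ℝ) < j := by exact_mod_cast hj
    have hsym := abs_autCoeff_symm (n := j) (m := m) hj (by omega)
    unfold eulerCoeff at h1 h2
    rw [abs_mul, Nat.abs_cast] at h1 h2
    rw [← hsym] at h2
    have hjb : (j : ℝ) ≤ 3 * min n m := by
      have : j ≤ 3 * min n m := by omega
      exact_mod_cast this
    have hprod := mul_le_mul h1 h2 (by positivity) (by positivity)
    have hsqrt : (min n m : ℕ) ≤ √n * √m := by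
      rw [← Real.sqrt_mul hn'.le]
      refine Real.le_sqrt_of_sq_le ?_
      have : (min n m) ^ 2 ≤ n * m := by
        rw [sq]; exact Nat.mul_le_mul (min_le_left _ _) (min_le_right _ _)
      exact_mod_cast this
    have h3 : c ^ 2 * (min n m : ℕ) ≤ (j * m) * P j := by
      calc c ^ 2 * (min n m : ℕ) ≤ c ^ 2 * (√n * √m) :=
            mul_le_mul_of_nonneg_left hsqrt (by positivity)
        _ = c * √n * (c * √m) := by ring
        _ ≤ _ := hprod
        _ = _ := by simp only [hP]; ring
    have hmin : (0 : ℝ) < (min n m : ℕ) := by exact_mod_cast (by omega : 0 < min n m)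
    have hmn' : (m : ℝ) ≤ 2 * n := by exact_mod_cast hmn
    have h4 : (j * m : ℝ) * P j ≤ (3 * (min n m : ℕ) * (2 * n)) * P j := by
      refine mul_le_mul_of_nonneg_right ?_ (hP0 j)
      exact mul_le_mul (by exact_mod_cast hjb) hmn' hm'.le (by positivity)
    have h5 : c ^ 2 ≤ 6 * n * P j := by
      have := h3.trans h4
      nlinarith
    rw [div_le_iff₀ (by positivity)]; linarith
  have htriple : ∀ k ∈ Finset.Ico a b, c ^ 2 / (6 * n) ≤ P k + P (k + 1) + P (k + 2) := by
    intro k hk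
    rw [Finset.mem_Ico] at hk
    obtain ⟨j, hj1, hj2, h1, h2⟩ := h n m k (by omega) (by omega) (by omega) (by omega)
      (by omega) (by omega)
    have := hPlow j (by omega) (by omega) h1 h2
    have p0 := hP0 k
    have p1 := hP0 (k + 1)
    have p2 := hP0 (k + 2)
    obtain rfl | rfl | rfl : j = k ∨ j = k + 1 ∨ j = k + 2 := by omega
    all_goals linarith
  have hshift : ∀ i ≤ 2, ∑ k ∈ Finset.Ico a b, P (k + i) ≤ ∑ k ∈ Finset.range (3 * n), P k := by
    intro i hi
    rw [Finset.sum_Ico_add']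
    refine Finset.sum_le_sum_of_subset_of_nonneg (fun k hk => ?_) fun k _ _ => hP0 k
    rw [Finset.mem_Ico] at hk
    rw [Finset.mem_range]
    omega
  have hsum := Finset.sum_le_sum htriple
  rw [Finset.sum_add_distrib, Finset.sum_add_distrib, Finset.sum_const, Nat.card_Ico,
    nsmul_eq_mul] at hsum
  have s0 := hshift 0 (by omega)
  have s1 := hshift 1 (by omega)
  have s2 := hshift 2 (by omega)
  have hcard : (n : ℝ) ≤ 20 * ((b - a : ℕ) : ℝ) := by
    have : n ≤ 20 * (b - a) := by omega
    exact_mod_cast this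
  have : c ^ 2 / 120 ≤ ((b - a : ℕ) : ℝ) * (c ^ 2 / (6 * n)) := by
    rw [mul_div_assoc', div_le_div_iff₀ (by norm_num) (by positivity)]
    nlinarith [mul_le_mul_of_nonneg_left hcard (sq_nonneg c)]
  simp only [add_zero] at s0
  linarith


/-! ### From the composition operator to its matrix, and comparison of weights. -/

/-- The disk automorphism `z ↦ (1 + 2 z) / (2 + z)`. -/
noncomputable def aut (z : ℂ) : ℂ := (1 + 2 * z) / (2 + z)

theorem coeff_eq_of_hasSum {f : ℂ → ℂ} {c : ℕ → ℂ}
    (h : ∀ z ∈ disk, HasSum (fun k => c k * z ^ k) (f z)) (n : ℕ) : coeff f n = c n := by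
  have hf : HasFPowerSeriesAt f (FormalMultilinearSeries.ofScalars ℂ c) 0 := by
    rw [hasFPowerSeriesAt_iff]
    filter_upwards [Metric.ball_mem_nhds (0 : ℂ) one_pos] with z hz
    simpa [FormalMultilinearSeries.coeff_ofScalars, mul_comm] using h z hz
  have h2 := hf.analyticAt.hasFPowerSeriesAt
  have := FormalMultilinearSeries.ofScalars_series_injective ℂ ℂ
    (h2.eq_formalMultilinearSeries hf)
  exact congrFun this n

theorem norm_lt_one_of_mem_disk {z : ℂ} (hz : z ∈ disk) : ‖z‖ < 1 := by
  simpa [disk] using hz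

theorem two_add_ne_zero {z : ℂ} (hz : z ∈ disk) : 2 + z ≠ 0 := by
  intro h
  have h1 : z = -2 := by linear_combination h
  have := norm_lt_one_of_mem_disk hz
  rw [h1] at this
  norm_num at this

theorem summable_autCoeff_mul_pow (n : ℕ) {z : ℂ} (hz : z ∈ disk) :
    Summable fun k => (autCoeff n k : ℂ) * z ^ k := by
  obtain ⟨B, hB⟩ := decays_autSeries_pow n
  have hs : Summable fun k : ℕ => B * (3 / 4 : ℝ) ^ k :=
    (summable_geometric_of_lt_one (by norm_num) (by norm_num)).mul_left _
  refine Summable.of_norm_bounded hs fun k => ?_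
  rw [norm_mul, norm_pow, Complex.norm_real, Real.norm_eq_abs]
  have h1 : ‖z‖ ^ k ≤ 1 := pow_le_one₀ (norm_nonneg _) (norm_lt_one_of_mem_disk hz).le
  exact (mul_le_of_le_one_right (abs_nonneg _) h1).trans (hB k)

theorem hasSum_aut_pow (n : ℕ) {z : ℂ} (hz : z ∈ disk) :
    HasSum (fun k => (autCoeff n k : ℂ) * z ^ k) (aut z ^ n) := by
  induction n with
  | zero =>
    have := hasSum_single (f := fun k => (autCoeff 0 k : ℂ) * z ^ k) 0 fun k hk => by
      simp [autCoeff_zero_left, hk]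
    simpa [autCoeff_zero_left] using this
  | succ n ih =>
    have s := summable_autCoeff_mul_pow (n + 1) hz
    have s0 := ih.summable
    have s' := (summable_nat_add_iff 1).2 s
    have s0' := (summable_nat_add_iff 1).2 s0
    have e := s.tsum_eq_zero_add
    have e0 := s0.tsum_eq_zero_add
    have key : ∑' k, (2 * ((autCoeff (n + 1) (k + 1) : ℂ) * z ^ (k + 1)) +
        z * ((autCoeff (n + 1) k : ℂ) * z ^ k)) =
        ∑' k, ((autCoeff n (k + 1) : ℂ) * z ^ (k + 1) +
          2 * z * ((autCoeff n k : ℂ) * z ^ k)) := by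
      refine tsum_congr fun k => ?_
      have := congrArg (fun x : ℝ => (x : ℂ)) (autCoeff_pascal n k)
      push_cast at this
      rw [pow_succ]
      linear_combination z ^ k * z * this
    rw [(s'.mul_left 2).tsum_add (s.mul_left z), s0'.tsum_add (s0.mul_left (2 * z)),
      tsum_mul_left, tsum_mul_left, tsum_mul_left] at key
    have h0 := congrArg (fun x : ℝ => (x : ℂ)) (autCoeff_pascal_zero n)
    push_cast at h0
    simp only [pow_zero, mul_one] at e e0
    have ht : ∑' k, (autCoeff (n + 1) k : ℂ) * z ^ k = aut z ^ (n + 1) := by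
      apply mul_left_cancel₀ (two_add_ne_zero hz)
      have h1 : (2 + z) * aut z ^ (n + 1) = (1 + 2 * z) * aut z ^ n := by
        have : (2 + z) * aut z = 1 + 2 * z := mul_div_cancel₀ _ (two_add_ne_zero hz)
        rw [pow_succ]
        linear_combination aut z ^ n * this
      rw [h1, ← ih.tsum_eq]
      linear_combination 2 * e - e0 + key + h0
    exact ht ▸ s.hasSum

theorem coeff_polynomial (F : Finset ℕ) (l : ℕ → ℝ) (n : ℕ) :
    coeff (fun z => ∑ k ∈ F, (l k : ℂ) * z ^ k) n = if n ∈ F then (l n : ℂ) else 0 := by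
  refine coeff_eq_of_hasSum (c := fun n => if n ∈ F then (l n : ℂ) else 0) (fun z _ => ?_) n
  have h : HasSum (fun k => (if k ∈ F then (l k : ℂ) else 0) * z ^ k)
      (∑ k ∈ F, (if k ∈ F then (l k : ℂ) else 0) * z ^ k) :=
    hasSum_sum_of_ne_finset_zero fun k hk => by simp [hk]
  rwa [Finset.sum_congr rfl fun k hk => by rw [if_pos hk]] at h

theorem coeff_polynomial_comp_aut (F : Finset ℕ) (l : ℕ → ℝ) (n : ℕ) :
    coeff ((fun z => ∑ k ∈ F, (l k : ℂ) * z ^ k) ∘ aut) n =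
      ((∑ k ∈ F, l k * autCoeff k n : ℝ) : ℂ) := by
  refine coeff_eq_of_hasSum (c := fun n => ((∑ k ∈ F, l k * autCoeff k n : ℝ) : ℂ))
    (fun z hz => ?_) n
  have := hasSum_sum fun k (_ : k ∈ F) => (hasSum_aut_pow k hz).mul_left (l k : ℂ)
  have e : (fun j => ((∑ k ∈ F, l k * autCoeff k j : ℝ) : ℂ) * z ^ j) =
      fun j => ∑ k ∈ F, (l k : ℂ) * ((autCoeff k j : ℂ) * z ^ j) := by
    funext j
    push_cast
    rw [Finset.sum_mul]
    exact Finset.sum_congr rfl fun _ _ => by ring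
  rw [e]
  exact this

theorem BoundedComposition.matrix_bound {β : ℕ → ℝ} (hpos : ∀ n, 0 < β n)
    (h : BoundedComposition β aut) : ∃ K : ℝ, ∀ (F J : Finset ℕ) (l : ℕ → ℝ),
      ∑ j ∈ J, (∑ k ∈ F, l k * autCoeff k j) ^ 2 * β j ≤ K ^ 2 * ∑ k ∈ F, l k ^ 2 * β k := by
  obtain ⟨K, hK⟩ := h
  refine ⟨K, fun F J l => ?_⟩
  set p : ℂ → ℂ := fun z => ∑ k ∈ F, (l k : ℂ) * z ^ k with hp
  have hsum : HasSum (fun n => ‖coeff p n‖ ^ 2 * β n) (∑ k ∈ F, l k ^ 2 * β k) := by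
    have : HasSum (fun n => ‖coeff p n‖ ^ 2 * β n) (∑ n ∈ F, ‖coeff p n‖ ^ 2 * β n) :=
      hasSum_sum_of_ne_finset_zero fun k hk => by
        rw [hp, coeff_polynomial, if_neg hk]; simp
    rwa [Finset.sum_congr rfl fun k hk => by
      rw [hp, coeff_polynomial, if_pos hk, Complex.norm_real, Real.norm_eq_abs, sq_abs]] at this
  have hpH : p ∈ H2 β := ⟨by fun_prop, hsum.summable⟩
  obtain ⟨⟨-, hs⟩, hle⟩ := hK p hpH
  have hnn : ∀ f : ℂ → ℂ, 0 ≤ ∑' n, ‖coeff f n‖ ^ 2 * β n := fun f =>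
    tsum_nonneg fun n => mul_nonneg (sq_nonneg _) (hpos n).le
  have hle2 := pow_le_pow_left₀ (Real.sqrt_nonneg _) hle 2
  unfold norm2 at hle2
  rw [mul_pow, Real.sq_sqrt (hnn _), Real.sq_sqrt (hnn _), hsum.tsum_eq] at hle2
  refine le_trans (le_trans (le_of_eq ?_)
    (hs.sum_le_tsum J fun n _ => mul_nonneg (sq_nonneg _) (hpos n).le)) hle2
  refine Finset.sum_congr rfl fun j _ => ?_
  rw [hp, coeff_polynomial_comp_aut, Complex.norm_real, Real.norm_eq_abs, sq_abs]

theorem isSymbol_aut : IsSymbol aut where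
  differentiableOn := by
    unfold aut
    exact DifferentiableOn.div (by fun_prop) (by fun_prop) fun z hz => two_add_ne_zero hz
  mapsTo := by
    intro z hz
    have h1 := norm_lt_one_of_mem_disk hz
    have h2 : 0 < ‖2 + z‖ := norm_pos_iff.2 (two_add_ne_zero hz)
    have h3 : ‖1 + 2 * z‖ < ‖2 + z‖ := by
      refine lt_of_pow_lt_pow_left₀ 2 (norm_nonneg _) ?_
      have h4 : ‖z‖ ^ 2 < 1 := by nlinarith [norm_nonneg z]
      rw [← Complex.normSq_eq_norm_sq, Complex.normSq_apply] at h4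
      rw [← Complex.normSq_eq_norm_sq, ← Complex.normSq_eq_norm_sq, Complex.normSq_apply,
        Complex.normSq_apply]
      simp
      nlinarith
    simpa [disk, aut, norm_div] using (div_lt_one h2).2 h3
  nonconstant := by
    rintro ⟨c, hc⟩
    have h0 := hc 0 (by simp [disk])
    have h1 := hc (-1 / 2) (by simp [disk]; norm_num)
    rw [← h1] at h0
    norm_num [aut] at h0

theorem aut_mem_H2 {β : ℕ → ℝ} (hpos : ∀ n : ℕ, 0 < β n)
    (hlim : Tendsto (fun n : ℕ => β n ^ ((1 : ℝ) / (n : ℝ))) atTop (𝓝 1)) : aut ∈ H2 β := by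
  refine ⟨isSymbol_aut.differentiableOn, ?_⟩
  have hc : ∀ k, coeff aut k = (autCoeff 1 k : ℂ) :=
    coeff_eq_of_hasSum fun z hz => by simpa using hasSum_aut_pow 1 hz
  obtain ⟨B, hB⟩ := decays_autSeries_pow 1
  -- Eventually βₙ ≤ (3/2)ⁿ, and (3/4)² · 3/2 = 27/32 < 1.
  have hs : Summable fun k : ℕ => B ^ 2 * (27 / 32 : ℝ) ^ k :=
    (summable_geometric_of_lt_one (by norm_num) (by norm_num)).mul_left _
  refine Summable.of_norm_bounded_eventually_nat hs ?_
  filter_upwards [hlim.eventually_lt_const (by norm_num : (1 : ℝ) < 3 / 2),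
    eventually_ge_atTop 1] with n h1 hn
  have hn' : (n : ℝ) ≠ 0 := by exact_mod_cast (by omega : n ≠ 0)
  have hb : β n ≤ (3 / 2) ^ n := by
    have h2 := pow_le_pow_left₀ (Real.rpow_nonneg (hpos n).le _) h1.le n
    rwa [← Real.rpow_natCast, ← Real.rpow_mul (hpos n).le, one_div_mul_cancel hn',
      Real.rpow_one] at h2
  rw [hc, Complex.norm_real, Real.norm_eq_abs, Real.norm_eq_abs, sq_abs,
    abs_of_nonneg (mul_nonneg (sq_nonneg _) (hpos n).le), ← sq_abs]
  calc |autCoeff 1 n| ^ 2 * β n ≤ (B * (3 / 4 : ℝ) ^ n) ^ 2 * (3 / 2) ^ n :=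
        mul_le_mul (pow_le_pow_left₀ (abs_nonneg _) (hB n) 2) hb (hpos n).le (by positivity)
    _ = B ^ 2 * (((3 / 4) ^ 2) * (3 / 2)) ^ n := by
        rw [mul_pow, mul_pow, ← pow_mul, ← pow_mul, mul_comm n 2]; ring
    _ = _ := by norm_num

theorem BoundedComposition.comparable {β : ℕ → ℝ} (hpos : ∀ n, 0 < β n)
    (h : BoundedComposition β aut) : ∃ C : ℝ, 0 ≤ C ∧ ∀ n m : ℕ, 16 ≤ n → 16 ≤ m →
      n ≤ 2 * m → m ≤ 2 * n → β m ≤ C * β n := by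
  obtain ⟨K, hK⟩ := h.matrix_bound hpos
  obtain ⟨c, hc, hsum⟩ := sum_abs_mul_abs_ge
  refine ⟨K ^ 4 / c ^ 2, by positivity, fun n m hn hm hnm hmn => ?_⟩
  set F := Finset.range (3 * n)
  -- The signs make every term of the m-th coefficient of the composition nonnegative.
  set l : ℕ → ℝ := fun k => |autCoeff n k| * (SignType.sign (autCoeff k m) : ℝ) with hl
  have h1 := hK {n} F fun _ => 1
  simp only [Finset.sum_singleton, one_mul, one_pow] at h1
  have h2 := hK F {m} l
  rw [Finset.sum_singleton] at h2
  have h3 : ∑ k ∈ F, l k * autCoeff k m = ∑ k ∈ F, |autCoeff n k| * |autCoeff k m| :=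
    Finset.sum_congr rfl fun k _ => by rw [hl, mul_assoc, sign_mul_self]
  have h4 : ∑ k ∈ F, l k ^ 2 * β k ≤ ∑ k ∈ F, autCoeff n k ^ 2 * β k := by
    refine Finset.sum_le_sum fun k _ => mul_le_mul_of_nonneg_right ?_ (hpos k).le
    simp only [hl, mul_pow, sq_abs]
    refine mul_le_of_le_one_right (sq_nonneg _) ?_
    rcases lt_trichotomy (autCoeff k m) 0 with h | h | h <;> simp [h]
  have h5 := hsum n m hn hm hnm hmn
  rw [← h3] at h5
  have h6 := mul_le_mul_of_nonneg_right (pow_le_pow_left₀ hc.le h5 2) (hpos m).le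
  have h7 := mul_le_mul_of_nonneg_left (h4.trans h1) (sq_nonneg K)
  rw [div_mul_eq_mul_div, le_div_iff₀ (by positivity)]
  nlinarith

end WeightedHardy

theorem theorem2p2 (β : ℕ → ℝ) (hpos : ∀ n : ℕ, 0 < β n)
    (hlim : Tendsto (fun n : ℕ => β n ^ ((1 : ℝ) / (n : ℝ))) atTop (𝓝 1))
    (hcomp : ∀ φ : ℂ → ℂ, WeightedHardy.IsSymbol φ → φ ∈ WeightedHardy.H2 β →
      WeightedHardy.BoundedComposition β φ) :
    WeightedHardy.SlowlyOscillating β := by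
  obtain ⟨C₀, hC₀, hlarge⟩ := (hcomp _ WeightedHardy.isSymbol_aut
    (WeightedHardy.aut_mem_H2 hpos hlim)).comparable hpos
  -- If one index is below 16, the other is at most 30; these finitely many ratios are absorbed in
  -- S.
  set S := ∑ i ∈ Finset.range 32, ∑ j ∈ Finset.range 32, β i / β j with hS
  have hnn : ∀ i j, 0 ≤ β i / β j := fun i j => (div_pos (hpos i) (hpos j)).le
  have hS0 : 0 ≤ S := Finset.sum_nonneg fun i _ => Finset.sum_nonneg fun j _ => hnn i j
  have hsmall : ∀ i j, i < 32 → j < 32 → β i ≤ S * β j := by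
    intro i j hi hj
    rw [← div_le_iff₀ (hpos j)]
    calc β i / β j ≤ ∑ j ∈ Finset.range 32, β i / β j :=
          Finset.single_le_sum (f := fun j => β i / β j) (fun j _ => hnn i j)
            (Finset.mem_range.2 hj)
      _ ≤ S := Finset.single_le_sum (f := fun i => ∑ j ∈ Finset.range 32, β i / β j)
          (fun i _ => Finset.sum_nonneg fun j _ => hnn i j) (Finset.mem_range.2 hi)
  have hall : ∀ n m : ℕ, n ≤ 2 * m → m ≤ 2 * n → β m ≤ (2 + C₀ + S) * β n := by
    intro n m hnm hmn
    have h0 := hpos n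
    have h1 := mul_nonneg hC₀ h0.le
    have h2 := mul_nonneg hS0 h0.le
    by_cases h : 16 ≤ n ∧ 16 ≤ m
    · linarith [hlarge n m h.1 h.2 hnm hmn]
    · linarith [hsmall m n (by omega) (by omega)]
  have hC : 1 < 2 + C₀ + S := by linarith
  refine ⟨(2 + C₀ + S)⁻¹, 2 + C₀ + S, by positivity, inv_lt_one_of_one_lt₀ hC, hC,
    fun m n h1 h2 => ?_⟩
  have h1' : n ≤ 2 * m := by
    have : (n : ℝ) ≤ 2 * m := by linarith
    exact_mod_cast this
  have h2' : m ≤ 2 * n := by exact_mod_cast h2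
  refine ⟨?_, hall n m h1' h2'⟩
  rw [inv_mul_le_iff₀ (by linarith)]
  exact hall m n h2' h1'
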